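/- Let $R$ be a commutative Noetherian ring with identity, let $\mathfrak a$ be an ideal of $R$ contained in the Jacobson radical of $R$, and let $M$ and $N$ be two nonzero finitely generated $R$-modules. For a finitely generated $R$-module $L$, let $\operatorname{grade}(\mathfrak a,L)$ be the supremum of the lengths of the $L$-regular sequences contained in $\mathfrak a$ if $\mathfrak aL\neq L$, and $\infty$ if $\mathfrak aL=L$; let $\operatorname{cd}(\mathfrak a,L)$ be the supremum of the integers $i\ge 0$ such that the local cohomology module $\operatorname{H}^i_{\mathfrak a}(L)=\varinjlim_n\operatorname{Ext}^i_R(R/\mathfrak a^n,L)$ is nonzero ($-\infty$ if there is no such $i$); and let $\operatorname{ara}(\mathfrak a,L)$ be the infimum of the integers $n\ge 0$ for which there exist $x_1,\dots,x_n\in R$ with $$\operatorname{Rad}\left(\langle x_1,\dots,x_n\rangle+\operatorname{Ann}_RL\right)=\operatorname{Rad}\left(\mathfrak a+\operatorname{Ann}_RL\right).$$ Assume that $N$ is $\mathfrak a$-relative Cohen-Macaulay, that is, either $N=\mathfrak aN$, or $N\neq\mathfrak aN$ and $\operatorname{grade}(\mathfrak a,N)=\operatorname{cd}(\mathfrak a,N)$,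 and assume that $\operatorname{cd}(\mathfrak a,N)=\operatorname{ara}(\mathfrak a,N)$. Then $$\operatorname{Ext}^i_R(N,M)=0\quad\text{for all integers } i<\operatorname{grade}(\mathfrak a,M)-\operatorname{cd}(\mathfrak a,N).$$ -/

import Mathlib

universe u

open CategoryTheory

noncomputable section

namespace RelativeCM

variable {R : Type u} [CommRing R]

open scoped Classical in
/-- `grade(𝔞, M)`: the supremum of the lengths of the `M`-regular sequences contained in `𝔞`
if `𝔞 M ≠ M`, and `∞` if `𝔞 M = M`. -/
def grade (a : Ideal R) (M : Type u) [AddCommGroup M] [Module R M] : ℕ∞ :=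
  if a • (⊤ : Submodule R M) = ⊤ then ⊤
  else ⨆ (rs : List R) (_ : ∀ r ∈ rs, r ∈ a) (_ : RingTheory.Sequence.IsRegular M rs),
    (rs.length : ℕ∞)

/-- `cd(𝔞, M)`: the supremum of the integers `i` such that the local cohomology module
`H^i_𝔞(M) = colim_n Ext^i(R/𝔞^n, M)` is nonzero (`⊥`, that is `-∞`, if there are none). -/
def cohomologicalDimension (a : Ideal R) (M : Type u) [AddCommGroup M] [Module R M] :
    WithBot ℕ∞ :=
  ⨆ (i : ℕ) (_ : Nontrivial ((localCohomology a i).obj (ModuleCat.of R M))),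
    ((i : ℕ∞) : WithBot ℕ∞)

/-- `ara(𝔞, M)`: the infimum of the integers `n ≥ 0` such that there are `x₁, …, xₙ ∈ R` with
`Rad(⟨x₁, …, xₙ⟩ + Ann M) = Rad(𝔞 + Ann M)`. -/
def arithmeticRank (a : Ideal R) (M : Type u) [AddCommGroup M] [Module R M] : ℕ∞ :=
  ⨅ (n : ℕ) (_ : ∃ x : Fin n → R,
      (Ideal.span (Set.range x) ⊔ Module.annihilator R M).radical =
        (a ⊔ Module.annihilator R M).radical),
    (n : ℕ∞)

/-- `M` is `𝔞`-relative Cohen-Macaulay: either `M = 𝔞 M`, or `M ≠ 𝔞 M` and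
`grade(𝔞, M) = cd(𝔞, M)`. -/
def IsRelativeCohenMacaulay (a : Ideal R) (M : Type u) [AddCommGroup M] [Module R M] : Prop :=
  a • (⊤ : Submodule R M) = ⊤ ∨
    (a • (⊤ : Submodule R M) ≠ ⊤ ∧ (grade a M : WithBot ℕ∞) = cohomologicalDimension a M)

end RelativeCM

end

open CategoryTheory Abelian

/-! Induct on c = ara(𝔞, N), which equals grade(𝔞, N) by hypothesis; cd enters only through this
equality. Let x₁, …, x_c ∈ 𝔞 generate 𝔞 up to radical modulo Ann N. If c > 0, the grade is positive,
so coset prime avoidance on Ass N yields an N-regular z ∈ x₁ + (x₂, …, x_c). Modulo z, the elements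
x₂, …, x_c suffice for N/zN, and the grade bound drops by one. If Ext^{i+1}(N/zN, M) = 0, then z
acts surjectively on Ext^i(N, M), which vanishes by Nakayama. At c = 0, N is supported on V(𝔞), and
Rees' vanishing below grade(𝔞, M) applies.

The grade of N is carried as vanishing of Ext^j(R/𝔞, N), which descends along any regular element by
the long exact sequence. -/

/-- Prime avoidance for cosets: if no prime of a finite family contains both `x` and `J`, then some
element of `x + J` avoids all of them. -/
theorem Ideal.exists_add_notMem_of_finite_primes {R : Type*} [CommRing R] (x : R) (J : Ideal R)
    {s : Set (Ideal R)} (hs : s.Finite) (hp : ∀ P ∈ s, P.IsPrime)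
    (hJ : ∀ P ∈ s, ¬ (x ∈ P ∧ J ≤ P)) :
    ∃ j ∈ J, ∀ P ∈ s, x + j ∉ P := by
  induction hn : s.ncard generalizing s with
  | zero =>
    rw [Set.ncard_eq_zero hs] at hn
    exact ⟨0, J.zero_mem, by simp [hn]⟩
  | succ n ih =>
    have hne : s.Nonempty := by
      rw [← Set.ncard_pos hs]
      omega
    -- Minimality of P ensures that no other prime of the family lies inside P, so their product is
    -- not contained in P.
    obtain ⟨P, hPmin⟩ := hs.exists_minimal hne
    have hPs : P ∈ s := hPmin.prop
    have hP := hp P hPs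
    have hfin : (s \ {P}).Finite := hs.sdiff
    obtain ⟨j, hj, havoid⟩ := ih hfin (fun Q hQ ↦ hp Q hQ.1) (fun Q hQ ↦ hJ Q hQ.1)
      (by rw [Set.ncard_sdiff_singleton_of_mem hPs, hn, Nat.add_sub_cancel])
    by_cases hxj : x + j ∈ P
    · have hJP : ¬ J ≤ P := fun h ↦ hJ P hPs ⟨(P.add_mem_iff_left (h hj)).mp hxj, h⟩
      have hprod : ¬ J * ∏ Q ∈ hfin.toFinset, Q ≤ P := by
        rw [hP.mul_le, hP.prod_le, not_or]
        refine ⟨hJP, ?_⟩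
        rintro ⟨Q, hQ, hQP⟩
        rw [Set.Finite.mem_toFinset] at hQ
        exact hQ.2 (le_antisymm hQP (hPmin.le_of_le hQ.1 hQP))
      -- Adding t moves the element out of P without changing its class modulo any other prime.
      obtain ⟨t, ht, htP⟩ := SetLike.not_le_iff_exists.mp hprod
      refine ⟨j + t, J.add_mem hj (Ideal.mul_le_left ht), fun Q hQ ↦ ?_⟩
      rw [← add_assoc]
      by_cases hQP : Q = P
      · subst hQP
        exact fun h ↦ htP ((Q.add_mem_iff_right hxj).mp h)
      · have htQ : t ∈ Q := Ideal.prod_le_inf.trans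
          (Finset.inf_le (hfin.mem_toFinset.mpr ⟨hQ, hQP⟩)) (Ideal.mul_le_right ht)
        exact fun h ↦ havoid Q ⟨hQ, hQP⟩ ((Q.add_mem_iff_left htQ).mp h)
    · refine ⟨j, hj, fun Q hQ ↦ ?_⟩
      by_cases hQP : Q = P
      · rwa [hQP]
      · exact havoid Q ⟨hQ, hQP⟩

/-- If `a` contains an `N`-regular element, and `a` is contained in the radical of
`(x) + J + Ann N`, then some element of `x + J` is `N`-regular. -/
theorem exists_isSMulRegular_add {R N : Type*} [CommRing R] [IsNoetherianRing R] [AddCommGroup N]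
    [Module R N] [Module.Finite R N] {a J : Ideal R} {x r : R} (hr : r ∈ a)
    (hreg : IsSMulRegular N r)
    (hrad : a ≤ (Ideal.span {x} ⊔ J ⊔ Module.annihilator R N).radical) :
    ∃ j ∈ J, IsSMulRegular N (x + j) := by
  have key (s : R) : IsSMulRegular N s ↔ ∀ P ∈ associatedPrimes R N, s ∉ P := by
    have h : s ∈ (⋃ P ∈ associatedPrimes R N, (P : Set R))ᶜ ↔ IsSMulRegular N s := by
      rw [biUnion_associatedPrimes_eq_compl_regular, compl_compl, Set.mem_ofPred_eq]
    rw [← h]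
    simp
  obtain ⟨j, hj, h⟩ := Ideal.exists_add_notMem_of_finite_primes x J (associatedPrimes.finite R N)
    (fun P hP ↦ hP.isPrime) fun P hP ⟨hx, hJ⟩ ↦ (key r).mp hreg P hP <| by
      -- An associated prime containing x and J also contains Ann N, hence the regular element r,
      -- which is absurd.
      refine (hP.isPrime.radical_le_iff.mpr ?_) (hrad hr)
      exact sup_le (sup_le ((Ideal.span_singleton_le_iff_mem P).mpr hx) hJ)
        (Submodule.annihilator_top (R := R) (M := N) ▸ hP.annihilator_le)
  exact ⟨j, hj, (key _).mpr h⟩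

/-- For `r` regular on `N` in the Jacobson radical, vanishing of `Ext^{i+1}(N/rN, M)` forces
vanishing of `Ext^i(N, M)`. -/
theorem ModuleCat.subsingleton_ext_of_quotSMulTop {R : Type u} [CommRing R] [IsNoetherianRing R]
    {N M : ModuleCat.{u} R} [Module.Finite R N] [Module.Finite R M] {r : R}
    (hr : r ∈ (⊥ : Ideal R).jacobson) (hreg : IsSMulRegular N r) (i : ℕ)
    (h : Subsingleton (Ext (ModuleCat.of R (QuotSMulTop r N)) M (i + 1))) :
    Subsingleton (Ext N M i) := by
  have hS := hreg.smulShortComplex_shortExact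
  have hle : (⊤ : Submodule R (Ext N M i)) ≤ Ideal.span {r} • ⊤ := by
    intro e _
    -- The obstruction to dividing e by r lies in Ext^{i+1}(N/rN, M) = 0.
    obtain ⟨e', he'⟩ := Ext.contravariant_sequence_exact₁ hS M (n₀ := i) e (add_comm 1 i)
      (h.elim _ _)
    have hsmul (y : Ext N M i) : (Ext.mk₀ (r • 𝟙 N)).comp y (zero_add i) = r • y := by
      rw [Ext.mk₀_smul, Ext.smul_comp, Ext.mk₀_id_comp]
    rw [ModuleCat.smulShortComplex_f_eq_smul_id] at he'
    rw [he'.symm.trans (hsmul e')]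
    exact Submodule.smul_mem_smul (Ideal.mem_span_singleton_self r) trivial
  have := Submodule.eq_bot_of_le_smul_of_le_jacobson_bot (Ideal.span {r})
    (⊤ : Submodule R (Ext N M i)) Module.Finite.fg_top hle
    ((Ideal.span_singleton_le_iff_mem _).mpr hr)
  exact (Submodule.subsingleton_iff R).mp (subsingleton_of_bot_eq_top this.symm)

/-- If `r` is regular on `N` and `Ext^j(L, N)` vanishes for `j < n + 1`, then `Ext^j(L, N/rN)`
vanishes for `j < n`. -/
theorem ModuleCat.subsingleton_ext_quotSMulTop {R : Type u} [CommRing R]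
    {L N : ModuleCat.{u} R} {r : R} (hreg : IsSMulRegular N r) {n : ℕ}
    (h : ∀ j < n + 1, Subsingleton (Ext L N j)) :
    ∀ j < n, Subsingleton (Ext L (ModuleCat.of R (QuotSMulTop r N)) j) := by
  intro j hj
  have zero₁ := AddCommGrpCat.isZero_of_iff_subsingleton.mpr (h j (by omega))
  have zero₂ := AddCommGrpCat.isZero_of_iff_subsingleton.mpr (h (j + 1) (by omega))
  exact AddCommGrpCat.subsingleton_of_isZero <| ShortComplex.Exact.isZero_of_both_zeros
    (Ext.covariant_sequence_exact₃' L hreg.smulShortComplex_shortExact j (j + 1) rfl)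
    (zero₁.eq_zero_of_src _) (zero₂.eq_zero_of_tgt _)

/-- If `c` elements of `a ⊆ Jac R` generate `a` up to radical modulo `Ann N`, the grade of `a` on
`N` is at least `c`, and `Ext^j(L, M) = 0` for `j < n` whenever `L` is supported on `V(a)`, then
`Ext^i(N, M) = 0` for `i + c < n`. -/
theorem ModuleCat.subsingleton_ext_of_le_radical {R : Type u} [CommRing R] [IsNoetherianRing R]
    {a : Ideal R} (ha : a ≤ (⊥ : Ideal R).jacobson) {M : ModuleCat.{u} R} [Module.Finite R M]
    {n : ℕ} (hM : ∀ L : ModuleCat.{u} R, Module.Finite R L →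
      Module.support R L ⊆ PrimeSpectrum.zeroLocus a → ∀ j < n, Subsingleton (Ext L M j))
    (c : ℕ) (x : Fin c → R) (hx : ∀ k, x k ∈ a) (N : ModuleCat.{u} R) [Module.Finite R N]
    (hrad : a ≤ (Ideal.span (Set.range x) ⊔ Module.annihilator R N).radical)
    (hN : ∀ j < c, Subsingleton (Ext (ModuleCat.of R (R ⧸ a)) N j))
    (i : ℕ) (hi : i + c < n) :
    Subsingleton (Ext N M i) := by
  induction c generalizing N i with
  | zero =>
    refine hM N inferInstance ?_ i hi
    rw [Module.support_eq_zeroLocus, PrimeSpectrum.zeroLocus_subset_zeroLocus_iff]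
    simpa [Set.range_eq_empty] using hrad
  | succ c ih =>
    -- Hom(R/𝔞, N) = 0 forces 𝔞 to contain an N-regular element.
    have : Subsingleton ((R ⧸ a) →ₗ[R] N) :=
      (Ext.addEquiv₀.trans ModuleCat.homAddEquiv).symm.subsingleton_congr.mpr (hN 0 c.succ_pos)
    obtain ⟨r, hr, hreg⟩ := IsSMulRegular.subsingleton_linearMap_iff.mp this
    rw [Ideal.annihilator_quotient] at hr
    set J := Ideal.span (Set.range (Fin.tail x)) with hJ
    have hspan : Ideal.span (Set.range x) = Ideal.span {x 0} ⊔ J := by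
      rw [hJ, ← Ideal.span_union, Set.singleton_union, ← Fin.range_cons, Fin.cons_self_tail]
    rw [hspan] at hrad
    obtain ⟨j, hj, hz⟩ := exists_isSMulRegular_add hr hreg hrad
    have hJa : J ≤ a := by
      rw [hJ, Ideal.span_le]
      rintro _ ⟨k, rfl⟩
      exact hx _
    refine subsingleton_ext_of_quotSMulTop (ha (a.add_mem (hx 0) (hJa hj))) hz i ?_
    refine ih (Fin.tail x) (fun k ↦ hx _) _ ?_ (subsingleton_ext_quotSMulTop hz hN) (i + 1)
      (by omega)
    refine hrad.trans (Ideal.radical_mono ?_)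
    set B := Module.annihilator R (QuotSMulTop (x 0 + j) N)
    have hzB : x 0 + j ∈ B := by
      rw [Module.mem_annihilator]
      intro m
      obtain ⟨m, rfl⟩ := Submodule.mkQ_surjective _ m
      rw [← map_smul, Submodule.mkQ_apply, Submodule.Quotient.mk_eq_zero]
      exact Submodule.smul_mem_pointwise_smul _ _ _ trivial
    have hNB : Module.annihilator R N ≤ B :=
      LinearMap.annihilator_le_of_surjective _ (Submodule.mkQ_surjective _)
    refine sup_le (sup_le ?_ le_sup_left) (hNB.trans le_sup_right)
    -- x₀ = (x₀ + j) - j, where x₀ + j kills the quotient and j ∈ J.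
    rw [Ideal.span_singleton_le_iff_mem, ← add_sub_cancel_right (x 0) j]
    exact Ideal.sub_mem _ (Ideal.mem_sup_right hzB) (Ideal.mem_sup_left hj)

/-- Generators up to radical modulo `B` of an ideal `a` can be chosen inside `a`. -/
theorem Ideal.exists_mem_le_radical_of_radical_eq {R : Type*} [CommRing R] {a B : Ideal R} {c : ℕ}
    {x : Fin c → R} (h : (Ideal.span (Set.range x) ⊔ B).radical = (a ⊔ B).radical) :
    ∃ y : Fin c → R, (∀ k, y k ∈ a) ∧ a ≤ (Ideal.span (Set.range y) ⊔ B).radical := by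
  have hmem (k : Fin c) : ∃ y ∈ a, x k ∈ (Ideal.span {y} ⊔ B).radical := by
    have : x k ∈ (a ⊔ B).radical :=
      h ▸ Ideal.le_radical (Ideal.mem_sup_left (Ideal.subset_span ⟨k, rfl⟩))
    obtain ⟨n, hn⟩ := this
    -- The new generator is the 𝔞-component of a power of x k.
    obtain ⟨y, hy, b, hb, hyb⟩ := Submodule.mem_sup.mp hn
    exact ⟨y, hy, n, hyb ▸ Ideal.add_mem _
      (Ideal.mem_sup_left (Ideal.mem_span_singleton_self y)) (Ideal.mem_sup_right hb)⟩
  choose y hya hxy using hmem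
  refine ⟨y, hya, (le_sup_left.trans Ideal.le_radical).trans (h.symm.trans_le ?_)⟩
  rw [Ideal.radical_le_radical_iff]
  refine sup_le (Ideal.span_le.mpr ?_) (le_sup_right.trans Ideal.le_radical)
  rintro _ ⟨k, rfl⟩
  exact Ideal.radical_mono (sup_le_sup_right (Ideal.span_mono (by simp)) B) (hxy k)

namespace RelativeCM

variable {R : Type u} [CommRing R]

/-- If `n ≤ grade(𝔞, M)` and `𝔞 M ≠ M`, then `Ext^i(L, M) = 0` for `i < n` and every finitely
generated `L` supported on `V(𝔞)`. -/
theorem subsingleton_ext_of_le_grade [IsNoetherianRing R] {a : Ideal R} {M : ModuleCat.{u} R}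
    [Module.Finite R M] (hM : a • (⊤ : Submodule R M) ≠ ⊤) {n : ℕ} (hn : (n : ℕ∞) ≤ grade a M)
    (L : ModuleCat.{u} R) [Module.Finite R L]
    (hL : Module.support R L ⊆ PrimeSpectrum.zeroLocus a) :
    ∀ i < n, Subsingleton (Ext L M i) := by
  intro i hi
  have hlt : (i : ℕ∞) < grade a M := lt_of_lt_of_le (by exact_mod_cast hi) hn
  rw [grade, if_neg hM] at hlt
  simp only [lt_iSup_iff] at hlt
  obtain ⟨rs, hmem, hreg, hlen⟩ := hlt
  exact ModuleCat.subsingleton_ext_of_exists_isRegular a L hL M hM.lt_top rs hmem hreg i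
    (by exact_mod_cast hlen)

/-- A finite infimum of natural numbers is attained. -/
theorem exists_radical_eq_of_arithmeticRank_eq {a : Ideal R} {N : Type u} [AddCommGroup N]
    [Module R N] {c : ℕ} (h : arithmeticRank a N = c) :
    ∃ x : Fin c → R, (Ideal.span (Set.range x) ⊔ Module.annihilator R N).radical =
      (a ⊔ Module.annihilator R N).radical := by
  have hlt : arithmeticRank a N < ((c + 1 : ℕ) : ℕ∞) := by
    rw [h]
    exact_mod_cast c.lt_succ_self
  simp only [arithmeticRank, iInf_lt_iff] at hlt
  obtain ⟨n, hx, hn⟩ := hlt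
  have hcn : (c : ℕ∞) ≤ n := h ▸ iInf₂_le n hx
  obtain rfl : n = c := by
    norm_cast at hcn hn
    omega
  exact hx

end RelativeCM

theorem proposition2 {R : Type u} [CommRing R] [IsNoetherianRing R]
    (a : Ideal R) (ha : a ≤ (⊥ : Ideal R).jacobson)
    (M N : Type u) [AddCommGroup M] [Module R M] [AddCommGroup N] [Module R N]
    [Module.Finite R M] [Module.Finite R N] [Nontrivial M] [Nontrivial N]
    (hN : RelativeCM.IsRelativeCohenMacaulay a N)
    (hcd : RelativeCM.cohomologicalDimension a N =
      (RelativeCM.arithmeticRank a N : WithBot ℕ∞))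
    (i : ℕ)
    (hi : (i : WithBot ℕ∞) + RelativeCM.cohomologicalDimension a N <
      (RelativeCM.grade a M : WithBot ℕ∞)) :
    Subsingleton (CategoryTheory.Abelian.Ext (ModuleCat.of R N) (ModuleCat.of R M) i) := by
  -- By Nakayama, 𝔞L ≠ L for nonzero finite L, so the degenerate case of the relative Cohen-Macaulay
  -- condition and the `⊤` branch of `grade` do not occur.
  have hne (L : Type u) [AddCommGroup L] [Module R L] [Module.Finite R L] [Nontrivial L] :
      a • (⊤ : Submodule R L) ≠ ⊤ :=
    (Submodule.top_ne_ideal_smul_of_le_jacobson_annihilator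
      (ha.trans (Ideal.jacobson_mono bot_le))).symm
  obtain hN | ⟨-, hN⟩ := hN
  · exact absurd hN (hne N)
  rw [hcd] at hN hi
  have hgrade : RelativeCM.grade a N = RelativeCM.arithmeticRank a N := WithBot.coe_injective hN
  have hi' : (i : ℕ∞) + RelativeCM.arithmeticRank a N < RelativeCM.grade a M := by
    exact_mod_cast hi
  have hfin : RelativeCM.arithmeticRank a N ≠ ⊤ := by
    intro h
    simp [h] at hi'
  obtain ⟨c, hc⟩ := ENat.ne_top_iff_exists.mp hfin
  obtain ⟨x, hx⟩ := RelativeCM.exists_radical_eq_of_arithmeticRank_eq hc.symm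
  obtain ⟨y, hya, hy⟩ := Ideal.exists_mem_le_radical_of_radical_eq hx
  rw [← hc] at hi' hgrade
  -- A natural number below the grade and just above i + c is all the induction needs, so finiteness
  -- of grade(𝔞, M) plays no role.
  have hle : ((i + c + 1 : ℕ) : ℕ∞) ≤ RelativeCM.grade a M := by
    push_cast
    exact Order.add_one_le_of_lt hi'
  refine ModuleCat.subsingleton_ext_of_le_radical ha (n := i + c + 1)
    (fun L _ hL ↦ RelativeCM.subsingleton_ext_of_le_grade (M := ModuleCat.of R M) (hne M) hle L hL)
    c y hya (ModuleCat.of R N) hy ?_ i (by omega)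
  refine RelativeCM.subsingleton_ext_of_le_grade (M := ModuleCat.of R N) (hne N) hgrade.ge _ ?_
  rw [Module.support_eq_zeroLocus, Ideal.annihilator_quotient]
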